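/- **Definitions.** For a standard Borel space $X$ let $GX$ be the set of probability measures on $X$, with the smallest $\sigma$-algebra making all evaluations $\mu\mapsto\mu(U)$ ($U\subseteq X$ measurable) measurable; $GX$ is again standard Borel, and $G$ is an endofunctor, by push-forward, of the category $\mathbf{Sbs}$ of standard Borel spaces and measurable maps. An *element-free distribution* is a function $\varphi:(0,1]\to\mathbb N$ with countable support and total weight $\mathrm{tt}(\varphi)=\sum_{r}\varphi(r)\,r\le 1$. The set $\nabla$ of these carries the $\sigma$-algebra generated by the sets $\{\varphi : \sum_{r\in U}\varphi(r)=k\}$, for $U\subseteq(0,1]$ Borel and $k\in\mathbb N$. For $\mu\in GX$, the *multiplicity count* $\mathrm{mc}(\mu)\in\nabla$ is $r\mapsto\#\{x\in X : \mu\{x\}=r\}$. For $\mu\in GX$ and $\varphi\in\nabla$, let $\mathrm{base}_X(\mu,\varphi)\in GGX$ be the law of the random probability measure $$(1-\mathrm{tt}(\varphi))\,\mu+\sum_{r}r\sum_{i=1}^{\varphi(r)}\delta_{x^r_i},$$ where the points $x^r_i$ ($r\in(0,1]$, $1\le i\le\varphi(r)$) are independent with law $\mu$. For $\omega\in G\nabla$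 and $\mu\in GX$, put $(\omega\gg\!=\mathrm{base}_X)(\mu)=\int_\nabla \mathrm{base}_X(\mu,\varphi)\,\omega(\mathrm d\varphi)\in GGX$. Let $\mathrm{Nat}(G,GG)$ be the set of natural transformations $G\Rightarrow GG$ of functors $\mathbf{Sbs}\to\mathbf{Sbs}$, and let $\mathscr U_{[0,1]}$ be the uniform distribution on $[0,1]$. **Theorem.** For every standard Borel space $X$ the maps $\mathrm{base}_X: GX\times\nabla\to GGX$ and $\mathrm{mc}:GX\to\nabla$ are measurable. For every $\omega\in G\nabla$ the family $\{\omega\gg\!=\mathrm{base}_X\}_{X\in\mathbf{Sbs}}$ is a natural transformation $G\Rightarrow GG$, and the maps $$\alpha: G\nabla\to\mathrm{Nat}(G,GG),\qquad \omega\mapsto\{\omega\gg\!=\mathrm{base}_X\}_{X\in\mathbf{Sbs}},$$ $$\beta:\mathrm{Nat}(G,GG)\to G\nabla,\qquad H\mapsto G(\mathrm{mc})\big(H_{[0,1]}(\mathscr U_{[0,1]})\big),$$ are mutually inverse bijections. -/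

import Mathlib

open CategoryTheory MeasureTheory
open scoped ENNReal

noncomputable section

/-- An element-free probability distribution: a countably supported multiset of weights in
`(0, 1]`, given by its multiplicity function, whose total weight is at most `1`. -/
structure ElementFreeDist where
  /-- The multiplicity of each weight. -/
  mult : Set.Ioc (0 : ℝ) 1 → ℕ
  countable_support : (Function.support mult).Countable
  tsum_le_one : ∑' r : Set.Ioc (0 : ℝ) 1, (mult r : ℝ≥0∞) * ENNReal.ofReal (r : ℝ) ≤ 1

/-- The `σ`-algebra on element-free distributions generated by the sets of those `φ` that have
exactly `k` weights, counted with multiplicity, in the Borel set `U ⊆ (0, 1]`. -/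
instance ElementFreeDist.instMeasurableSpace : MeasurableSpace ElementFreeDist :=
  MeasurableSpace.generateFrom
    {D | ∃ U : Set (Set.Ioc (0 : ℝ) 1), MeasurableSet U ∧ ∃ k : ℕ,
      D = {φ : ElementFreeDist | ∑' r : U, (φ.mult r : ℝ≥0∞) = k}}

/-- The total weight of an element-free distribution. -/
def ElementFreeDist.totalWeight (φ : ElementFreeDist) : ℝ≥0∞ :=
  ∑' r : Set.Ioc (0 : ℝ) 1, (φ.mult r : ℝ≥0∞) * ENNReal.ofReal (r : ℝ)

/-- The entries of the multiset `φ`: the pairs `(r, i)` with `i < φ(r)`. The cardinality of this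
type is the size of `φ`, so families indexed by it are the sequences of that length, with the
entries belonging to the same weight `r` grouped together. -/
abbrev ElementFreeDist.Entries (φ : ElementFreeDist) : Type :=
  (r : Set.Ioc (0 : ℝ) 1) × Fin (φ.mult r)

section Multiplicity

variable {X : Type*} [MeasurableSpace X] [MeasurableSingletonClass X]

lemma tsum_atoms_le_one (μ : ProbabilityMeasure X) :
    ∑' x : X, (μ : Measure X) {x} ≤ 1 := by
  refine (ENNReal.tsum_eq_iSup_sum (f := fun x : X => (μ : Measure X) {x})).le.trans
    (iSup_le fun s => ?_)
  rw [sum_measure_singleton]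
  exact prob_le_one

/-- Only finitely many points have a given positive mass, so that the cardinality in the
multiplicity count is a genuine one. -/
lemma finite_setOf_measure_singleton_eq (μ : ProbabilityMeasure X) (r : Set.Ioc (0 : ℝ) 1) :
    {x : X | (μ : Measure X) {x} = ENNReal.ofReal (r : ℝ)}.Finite := by
  refine Set.Finite.subset (ENNReal.finite_const_le_of_tsum_ne_top
    (a := fun x : X => (μ : Measure X) {x}) (ne_top_of_le_ne_top ENNReal.one_ne_top
      (tsum_atoms_le_one μ)) (ε := ENNReal.ofReal (r : ℝ)) ?_) fun x hx => ?_
  · simpa using r.2.1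
  · exact (show (μ : Measure X) {x} = ENNReal.ofReal (r : ℝ) from hx).ge

lemma tsum_ncard_mul_le_one (μ : ProbabilityMeasure X) :
    ∑' r : Set.Ioc (0 : ℝ) 1,
      (({x : X | (μ : Measure X) {x} = ENNReal.ofReal (r : ℝ)}.ncard : ℕ) : ℝ≥0∞) *
        ENNReal.ofReal (r : ℝ) ≤ 1 := by
  have h (r : Set.Ioc (0 : ℝ) 1) :
      (({x : X | (μ : Measure X) {x} = ENNReal.ofReal (r : ℝ)}.ncard : ℕ) : ℝ≥0∞) *
        ENNReal.ofReal (r : ℝ) =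
      ∑' x : {x : X | (μ : Measure X) {x} = ENNReal.ofReal (r : ℝ)},
        (μ : Measure X) {(x : X)} := by
    have hfin := finite_setOf_measure_singleton_eq μ r
    have := hfin.fintype
    rw [tsum_congr (g := fun _ => ENNReal.ofReal (r : ℝ)) (fun x => x.2), tsum_fintype,
      Finset.sum_const, Finset.card_univ, nsmul_eq_mul, ← Nat.card_eq_fintype_card,
      Nat.card_coe_set_eq]
  simp_rw [h]
  rw [← ENNReal.tsum_sigma
    (fun (r : Set.Ioc (0 : ℝ) 1)
      (x : {x : X | (μ : Measure X) {x} = ENNReal.ofReal (r : ℝ)}) =>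
        (μ : Measure X) {(x : X)})]
  refine le_trans (ENNReal.tsum_comp_le_tsum_of_injective
    (f := fun p : (r : Set.Ioc (0 : ℝ) 1) ×
      {x : X | (μ : Measure X) {x} = ENNReal.ofReal (r : ℝ)} => (p.2 : X)) ?_
    (fun x : X => (μ : Measure X) {x})) (tsum_atoms_le_one μ)
  rintro ⟨r, x, hx⟩ ⟨r', x', hx'⟩ hxx
  obtain rfl : x = x' := hxx
  have hr : r = r' := by
    have h2 : ENNReal.ofReal (r : ℝ) = ENNReal.ofReal (r' : ℝ) :=
      (show (μ : Measure X) {x} = _ from hx).symm.trans hx'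
    exact Subtype.ext ((ENNReal.ofReal_eq_ofReal_iff r.2.1.le r'.2.1.le).1 h2)
  subst hr
  rfl

/-- The multiplicity count of a probability measure: `r ↦ #{x | μ {x} = r}`. -/
def multCount (μ : ProbabilityMeasure X) : ElementFreeDist where
  mult r := {x : X | (μ : Measure X) {x} = ENNReal.ofReal (r : ℝ)}.ncard
  countable_support := by
    refine (Summable.countable_support_ennreal
      (ne_top_of_le_ne_top ENNReal.one_ne_top (tsum_ncard_mul_le_one μ))).mono fun r hr => ?_
    simp only [Function.mem_support] at hr ⊢
    refine mul_ne_zero (by exact_mod_cast hr) ?_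
    simpa using r.2.1
  tsum_le_one := tsum_ncard_mul_le_one μ

end Multiplicity

section Base

variable {X : Type*} [MeasurableSpace X]

/-- The subprobability measure `∑_r r · ∑_{i < φ(r)} δ_{x (r, i)}`. -/
def ElementFreeDist.alloc (φ : ElementFreeDist) (x : φ.Entries → X) : Measure X :=
  Measure.sum fun s : φ.Entries => ENNReal.ofReal (s.1 : ℝ) • Measure.dirac (x s)

lemma ElementFreeDist.alloc_univ (φ : ElementFreeDist) (x : φ.Entries → X) :
    φ.alloc x Set.univ = φ.totalWeight := by
  simp only [ElementFreeDist.alloc, ElementFreeDist.totalWeight,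
    Measure.sum_apply _ MeasurableSet.univ, Measure.smul_apply, measure_univ, smul_eq_mul,
    mul_one]
  rw [ENNReal.tsum_sigma (fun (r : Set.Ioc (0 : ℝ) 1) (_ : Fin (φ.mult r)) =>
    ENNReal.ofReal (r : ℝ))]
  simp

instance ElementFreeDist.countable_entries (φ : ElementFreeDist) : Countable φ.Entries := by
  have : Countable (Function.support φ.mult) := φ.countable_support
  refine Function.Injective.countable
    (β := (r : Function.support φ.mult) × Fin (φ.mult r))
    (f := fun s => ⟨⟨s.1, fun h => (Fin.cast h s.2).elim0⟩, s.2⟩) ?_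
  rintro ⟨r, i⟩ ⟨r', i'⟩ h
  simp only [Sigma.mk.injEq] at h
  obtain ⟨h1, h2⟩ := h
  obtain rfl : r = r' := congrArg Subtype.val h1
  obtain rfl := eq_of_heq h2
  rfl

/-- The probability measure `(1 - tt(φ)) μ + alloc(φ, x)`. -/
def ElementFreeDist.fill (φ : ElementFreeDist) (μ : ProbabilityMeasure X)
    (x : φ.Entries → X) : ProbabilityMeasure X :=
  ⟨(1 - φ.totalWeight) • (μ : Measure X) + φ.alloc x, ⟨by
    rw [Measure.add_apply, Measure.smul_apply, measure_univ, smul_eq_mul, mul_one,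
      φ.alloc_univ, tsub_add_cancel_of_le (show φ.totalWeight ≤ 1 from φ.tsum_le_one)]⟩⟩

lemma ElementFreeDist.measurable_fill (φ : ElementFreeDist) (μ : ProbabilityMeasure X) :
    Measurable (φ.fill μ) := by
  refine Measurable.subtype_mk (Measure.measurable_of_measurable_coe _ fun s hs => ?_)
  simp only [Measure.add_apply, ElementFreeDist.alloc, Measure.sum_apply _ hs,
    Measure.smul_apply, Measure.dirac_apply' _ hs, smul_eq_mul]
  refine measurable_const.add (Measurable.tsum fun i => measurable_const.mul ?_)
  exact (measurable_one.indicator hs).comp (measurable_pi_apply i)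

/-- Drawing elements from the base measure `μ`: the law of `(1 - tt(φ)) μ + alloc(φ, x)` when the
family `x`, indexed by the entries of `φ`, is independent and identically distributed with law
`μ`. -/
def baseKernel (μ : ProbabilityMeasure X) (φ : ElementFreeDist) :
    ProbabilityMeasure (ProbabilityMeasure X) :=
  ⟨(Measure.infinitePi fun _ : φ.Entries => (μ : Measure X)).map (φ.fill μ),
    Measure.isProbabilityMeasure_map (φ.measurable_fill μ).aemeasurable⟩

end Base

/-- The functor of probability measures on measurable spaces: on maps it is the push-forward. -/
def giryProb : MeasCat.{0} ⥤ MeasCat.{0} where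
  obj X := MeasCat.of (ProbabilityMeasure X)
  map {X _} f := ⟨fun μ : ProbabilityMeasure X => μ.map (f := f.1) f.2.aemeasurable,
    Measurable.subtype_mk ((Measure.measurable_map f.1 f.2).comp measurable_subtype_coe)⟩
  map_id X := Subtype.ext <| funext fun μ : ProbabilityMeasure X =>
    Subtype.ext (Measure.map_id (μ := (μ : Measure X)))
  map_comp {X _ _} f g := Subtype.ext <| funext fun μ : ProbabilityMeasure X =>
    Subtype.ext (Measure.map_map (μ := (μ : Measure X)) g.2 f.2).symm

/-- The category of standard Borel spaces and measurable functions, as a full subcategory of the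
category of measurable spaces. -/
abbrev Sbs : Type 1 :=
  ObjectProperty.FullSubcategory fun X : MeasCat.{0} => StandardBorelSpace X

/-- The inclusion of standard Borel spaces in measurable spaces. -/
abbrev sbsInclusion : Sbs ⥤ MeasCat.{0} :=
  ObjectProperty.ι fun X : MeasCat.{0} => StandardBorelSpace X

/-- The natural transformations `G ⟶ G G` on standard Borel spaces. As the subcategory is full, it
does not matter that the functors are written here with values in measurable spaces. -/
abbrev GiryNat : Type 1 :=
  (sbsInclusion ⋙ giryProb) ⟶ (sbsInclusion ⋙ giryProb ⋙ giryProb)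

/-- The component of a natural transformation at a standard Borel space, as a function. -/
def GiryNat.component (H : GiryNat) (X : Type) [MeasurableSpace X] [hX : StandardBorelSpace X]
    (μ : ProbabilityMeasure X) : ProbabilityMeasure (ProbabilityMeasure X) :=
  (H.app ⟨MeasCat.of X, hX⟩).1 μ

/-- The uniform distribution on `[0, 1]`. -/
def uniformUnit : ProbabilityMeasure unitInterval :=
  ⟨volume, inferInstance⟩

end

/-!
Let `H` be a natural transformation and let `Q` be its component at the uniform distribution on the
circle. Naturality along `blockMap N θ`, which wraps `[0, 1]` around the circle `N` times and
rotates the `j`-th lap by `θ j`, writes `Q` as a push-forward of the component `P` at the uniform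
distribution on `[0, 1]`, for all `N` and `θ`. Average over independent uniform rotations `θ` and
let `N → ∞`: any two distinct points of `[0, 1]` eventually lie on different laps, so a sample from
the random measure with law `Q` arises by partitioning the index set according to the coincidences
in a sample from the random measure with law `P`, and then giving the blocks independent uniform
labels. The random partition depends on a measure `ν` only through `multCount ν`, because two
measures with the same multiplicity count have a coupling that preserves coincidences. The laws of
finite samples determine the law of a random measure, and every probability measure on a standard
Borel space is an image of the uniform distribution on the circle, so `multCount` of the component
at `[0, 1]` determines `H`. Since the multiplicity count of `base(μ, φ)` is `φ` almost surely when
`μ` has no atoms, every law of element-free distributions occurs.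
-/

open ProbabilityTheory Set Filter Topology

section GiryMap

variable {X Y : Type*} [MeasurableSpace X] [MeasurableSpace Y] {f : X → Y}

/-- Push-forward of probability measures along a measurable map: the action of the functor `G` on
morphisms. -/
noncomputable def giryMap (hf : Measurable f) (μ : ProbabilityMeasure X) : ProbabilityMeasure Y :=
  μ.map hf.aemeasurable

lemma coe_giryMap (hf : Measurable f) (μ : ProbabilityMeasure X) :
    (giryMap hf μ : Measure Y) = (μ : Measure X).map f :=
  rfl

lemma measurable_giryMap (hf : Measurable f) : Measurable (giryMap hf) :=
  Measurable.subtype_mk ((Measure.measurable_map f hf).comp measurable_subtype_coe)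

end GiryMap

namespace ElementFreeDist

attribute [ext] ElementFreeDist

lemma tsum_mult_mul (φ : ElementFreeDist) (f : Ioc (0 : ℝ) 1 → ℝ≥0∞) :
    ∑' r, (φ.mult r : ℝ≥0∞) * f r = ∑' s : φ.Entries, f s.1 := by
  rw [ENNReal.tsum_sigma fun (r : Ioc (0 : ℝ) 1) (_ : Fin (φ.mult r)) => f r]
  simp

lemma totalWeight_eq_tsum (φ : ElementFreeDist) :
    φ.totalWeight = ∑' s : φ.Entries, ENNReal.ofReal (s.1 : ℝ) :=
  φ.tsum_mult_mul fun r => ENNReal.ofReal (r : ℝ)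

/-- The number of weights in the set `U`, counted with multiplicity. -/
noncomputable def count (φ : ElementFreeDist) (U : Set (Ioc (0 : ℝ) 1)) : ℕ∞ :=
  {s : φ.Entries | s.1 ∈ U}.encard

lemma toENNReal_count (φ : ElementFreeDist) (U : Set (Ioc (0 : ℝ) 1)) :
    (φ.count U : ℝ≥0∞) = ∑' s : φ.Entries, U.indicator 1 s.1 := by
  rw [count, ← ENNReal.tsum_set_one, tsum_subtype _ fun _ => (1 : ℝ≥0∞)]
  rfl

lemma tsum_mult_eq_count (φ : ElementFreeDist) (U : Set (Ioc (0 : ℝ) 1)) :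
    ∑' r : U, (φ.mult r : ℝ≥0∞) = φ.count U := by
  rw [toENNReal_count, ← φ.tsum_mult_mul (U.indicator 1),
    tsum_subtype U fun r => (φ.mult r : ℝ≥0∞)]
  refine tsum_congr fun r => ?_
  by_cases hr : r ∈ U <;> simp [hr]

lemma measurable_count {U : Set (Ioc (0 : ℝ) 1)} (hU : MeasurableSet U) :
    Measurable fun φ : ElementFreeDist => φ.count U := by
  refine ENat.measurable_iff.2 fun k => MeasurableSpace.measurableSet_generateFrom ⟨U, hU, k, ?_⟩
  ext φ
  rw [mem_ofPred_eq, tsum_mult_eq_count]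
  norm_cast

lemma measurable_of_count {α : Type*} [MeasurableSpace α] {f : α → ElementFreeDist}
    (hf : ∀ U, MeasurableSet U → Measurable fun a => ((f a).count U : ℝ≥0∞)) :
    Measurable f := by
  refine measurable_generateFrom ?_
  rintro _ ⟨U, hU, k, rfl⟩
  simp only [tsum_mult_eq_count]
  exact hf U hU (measurableSet_singleton (k : ℝ≥0∞))

section Alloc

variable {X Y : Type*} [MeasurableSpace X] [MeasurableSpace Y] (φ : ElementFreeDist)

lemma alloc_apply (x : φ.Entries → X) {A : Set X} (hA : MeasurableSet A) :
    φ.alloc x A = ∑' s : φ.Entries, ENNReal.ofReal (s.1 : ℝ) * A.indicator 1 (x s) := by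
  simp [alloc, Measure.sum_apply _ hA, Measure.dirac_apply' _ hA]

lemma alloc_map (x : φ.Entries → X) {f : X → Y} (hf : Measurable f) :
    (φ.alloc x).map f = φ.alloc (f ∘ x) := by
  simp only [alloc, Measure.map_sum hf.aemeasurable, Measure.map_smul, Measure.map_dirac' hf,
    Function.comp_apply]

lemma coe_fill (μ : ProbabilityMeasure X) (x : φ.Entries → X) :
    (φ.fill μ x : Measure X) = (1 - φ.totalWeight) • (μ : Measure X) + φ.alloc x :=
  rfl

lemma fill_map (μ : ProbabilityMeasure X) {f : X → Y} (hf : Measurable f)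
    (x : φ.Entries → X) :
    giryMap hf (φ.fill μ x) = φ.fill (giryMap hf μ) (f ∘ x) := by
  apply ProbabilityMeasure.toMeasure_injective
  rw [coe_giryMap, coe_fill, coe_fill, coe_giryMap, Measure.map_add _ _ hf, Measure.map_smul,
    alloc_map _ _ hf]

end Alloc

end ElementFreeDist

lemma ofReal_Ioc_injective :
    Function.Injective fun r : Ioc (0 : ℝ) 1 => ENNReal.ofReal (r : ℝ) := fun r r' h =>
  Subtype.ext ((ENNReal.ofReal_eq_ofReal_iff r.2.1.le r'.2.1.le).1 h)

lemma exists_ofReal_Ioc_eq {t : ℝ≥0∞} (h0 : t ≠ 0) (h1 : t ≤ 1) :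
    ∃ r : Ioc (0 : ℝ) 1, ENNReal.ofReal (r : ℝ) = t := by
  have ht : t ≠ ∞ := ne_top_of_le_ne_top ENNReal.one_ne_top h1
  exact ⟨⟨t.toReal, ENNReal.toReal_pos h0 ht,
    ENNReal.toReal_le_of_le_ofReal zero_le_one (by simpa using h1)⟩, ENNReal.ofReal_toReal ht⟩

section Atoms

variable {X : Type*} [MeasurableSpace X]

/-- The injective family `a` lists the atoms of `ν`, an entry `(r, i)` of `φ` standing for an atom
of mass `r`. -/
structure IsAtomEnumeration {φ : ElementFreeDist} (ν : ProbabilityMeasure X)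
    (a : φ.Entries → X) : Prop where
  injective : Function.Injective a
  measure_singleton : ∀ s, (ν : Measure X) {a s} = ENNReal.ofReal (s.1 : ℝ)
  mem_range : ∀ y, (ν : Measure X) {y} ≠ 0 → y ∈ range a

lemma IsAtomEnumeration.measure_singleton_eq_zero {φ : ElementFreeDist} {ν : ProbabilityMeasure X}
    {a : φ.Entries → X} (ha : IsAtomEnumeration ν a) {y : X} (hy : y ∉ range a) :
    (ν : Measure X) {y} = 0 :=
  not_not.1 fun h => hy (ha.mem_range y h)

section Enumeration

variable [MeasurableSingletonClass X] {ν : ProbabilityMeasure X}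

lemma exists_isAtomEnumeration (ν : ProbabilityMeasure X) :
    ∃ a : (multCount ν).Entries → X, IsAtomEnumeration ν a := by
  have hfinite (r : Ioc (0 : ℝ) 1) :
      Finite {x : X | (ν : Measure X) {x} = ENNReal.ofReal (r : ℝ)} :=
    finite_setOf_measure_singleton_eq ν r
  let e (r : Ioc (0 : ℝ) 1) : Fin ((multCount ν).mult r) ≃
      {x : X | (ν : Measure X) {x} = ENNReal.ofReal (r : ℝ)} :=
    (Finite.equivFinOfCardEq (Nat.card_coe_set_eq _)).symm
  have he (r : Ioc (0 : ℝ) 1) (i) : (ν : Measure X) {(e r i : X)} = ENNReal.ofReal (r : ℝ) :=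
    (e r i).2
  refine ⟨fun s => e s.1 s.2, ?_, fun s => he s.1 s.2, fun y hy => ?_⟩
  · rintro ⟨r, i⟩ ⟨r', i'⟩ (h : (e r i : X) = e r' i')
    obtain rfl : r = r' := ofReal_Ioc_injective (by simp only [← he r i, h, he r' i'])
    rw [(e r).injective (Subtype.ext h)]
  · obtain ⟨r, hr⟩ := exists_ofReal_Ioc_eq hy prob_le_one
    exact ⟨⟨r, (e r).symm ⟨y, hr.symm⟩⟩, by simp⟩

namespace IsAtomEnumeration

variable {φ : ElementFreeDist} {a : φ.Entries → X}

lemma multCount_eq (ha : IsAtomEnumeration ν a) : multCount ν = φ := by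
  ext r
  have hatoms : {y : X | (ν : Measure X) {y} = ENNReal.ofReal (r : ℝ)} =
      range fun i : Fin (φ.mult r) => a ⟨r, i⟩ := by
    ext y
    by_cases hy : y ∈ range a
    · obtain ⟨⟨r', i⟩, rfl⟩ := hy
      rw [mem_ofPred_eq, ha.measure_singleton, ofReal_Ioc_injective.eq_iff]
      constructor
      · rintro rfl
        exact mem_range_self i
      · rintro ⟨j, hj⟩
        exact (congrArg Sigma.fst (ha.injective hj)).symm
    · rw [mem_ofPred_eq, ha.measure_singleton_eq_zero hy, eq_comm, ENNReal.ofReal_eq_zero]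
      refine iff_of_false r.2.1.not_ge ?_
      rintro ⟨i, rfl⟩
      exact hy (mem_range_self _)
  have hinj : Function.Injective fun i : Fin (φ.mult r) => a ⟨r, i⟩ :=
    ha.injective.comp sigma_mk_injective
  simp only [multCount]
  rw [hatoms, ← image_univ, ncard_image_of_injective _ hinj, ncard_univ, Nat.card_fin]

lemma setLIntegral_range (ha : IsAtomEnumeration ν a) (f : X → ℝ≥0∞) :
    ∫⁻ x in range a, f x ∂ν = ∑' s : φ.Entries, ENNReal.ofReal (s.1 : ℝ) * f (a s) := by
  rw [lintegral_countable _ (countable_range a),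
    tsum_range (fun x => f x * (ν : Measure X) {x}) ha.injective]
  simp only [ha.measure_singleton, mul_comm]

lemma restrict_range (ha : IsAtomEnumeration ν a) :
    (ν : Measure X).restrict (range a) = φ.alloc a := by
  ext A hA
  rw [← lintegral_indicator_one hA, ha.setLIntegral_range, φ.alloc_apply a hA]

lemma restrict_compl_add_alloc (ha : IsAtomEnumeration ν a) :
    (ν : Measure X).restrict (range a)ᶜ + φ.alloc a = ν := by
  rw [← ha.restrict_range, add_comm,
    Measure.restrict_add_restrict_compl (countable_range a).measurableSet]

lemma lintegral_comp_measure_singleton (ha : IsAtomEnumeration ν a) {g : ℝ≥0∞ → ℝ≥0∞}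
    (hg : g 0 = 0) :
    ∫⁻ x, g ((ν : Measure X) {x}) ∂ν = ∑' s : φ.Entries,
      ENNReal.ofReal (s.1 : ℝ) * g (ENNReal.ofReal (s.1 : ℝ)) := by
  have hm : MeasurableSet (range a) := (countable_range a).measurableSet
  have hcompl : ∫⁻ x in (range a)ᶜ, g ((ν : Measure X) {x}) ∂ν = 0 := by
    rw [setLIntegral_congr_fun hm.compl fun x hx => by
      rw [ha.measure_singleton_eq_zero hx, hg], lintegral_zero]
  rw [← lintegral_add_compl _ hm, hcompl, add_zero, ha.setLIntegral_range]
  simp only [ha.measure_singleton]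

end IsAtomEnumeration

/-- An atom of mass `t` contributes `t * t⁻¹ = 1` to the integral. -/
lemma count_multCount_eq_lintegral (ν : ProbabilityMeasure X) (U : Set (Ioc (0 : ℝ) 1)) :
    ((multCount ν).count U : ℝ≥0∞) =
      ∫⁻ x, ((fun r : Ioc (0 : ℝ) 1 => ENNReal.ofReal (r : ℝ)) '' U).indicator (·⁻¹)
        ((ν : Measure X) {x}) ∂ν := by
  obtain ⟨a, ha⟩ := exists_isAtomEnumeration ν
  have hpos (r : Ioc (0 : ℝ) 1) : ENNReal.ofReal (r : ℝ) ≠ 0 := by simpa using r.2.1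
  rw [ha.lintegral_comp_measure_singleton (g := indicator _ _), ElementFreeDist.toENNReal_count]
  · refine tsum_congr fun s => ?_
    by_cases hs : s.1 ∈ U
    · rw [indicator_of_mem hs, indicator_of_mem (mem_image_of_mem _ hs), Pi.one_apply,
        ENNReal.mul_inv_cancel (hpos s.1) ENNReal.ofReal_ne_top]
    · rw [indicator_of_notMem hs, indicator_of_notMem
        (mt ofReal_Ioc_injective.mem_set_image.1 hs), mul_zero]
  · exact indicator_of_notMem (by rintro ⟨r, -, hr⟩; exact hpos r hr) _

end Enumeration

/-- The identity, as a Markov kernel from probability measures to points. -/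
noncomputable def evalKernel (X : Type*) [MeasurableSpace X] : Kernel (ProbabilityMeasure X) X :=
  ⟨fun ν => ν, measurable_subtype_coe⟩

instance : IsMarkovKernel (evalKernel X) := ⟨fun ν => ν.2⟩

section MeasurableEq

variable [MeasurableEq X]

lemma measurable_measure_singleton :
    Measurable fun p : ProbabilityMeasure X × X => (p.1 : Measure X) {p.2} :=
  Kernel.measurable_kernel_prodMk_left (κ := (evalKernel X).comap
    (Prod.fst : ProbabilityMeasure X × X → _) measurable_fst)
    (measurableSet_eq_fun measurable_snd measurable_fst.snd)

lemma measurable_multCount : Measurable (multCount : ProbabilityMeasure X → ElementFreeDist) := by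
  have : StandardBorelSpace (Ioc (0 : ℝ) 1) := measurableSet_Ioc.standardBorel
  have hinj : MeasurableEmbedding fun r : Ioc (0 : ℝ) 1 => ENNReal.ofReal (r : ℝ) :=
    (ENNReal.measurable_ofReal.comp measurable_subtype_coe).measurableEmbedding ofReal_Ioc_injective
  refine ElementFreeDist.measurable_of_count fun U hU => ?_
  simp only [count_multCount_eq_lintegral]
  exact Measurable.lintegral_kernel_prod_right (κ := evalKernel X)
    ((measurable_inv.indicator (hinj.measurableSet_image.2 hU)).comp measurable_measure_singleton)

end MeasurableEq

end Atoms

namespace ElementFreeDist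

/-- The sort key of an entry: entries are listed by decreasing weight, and those of equal weight by
increasing index. -/
def entryKey (φ : ElementFreeDist) (s : φ.Entries) : (Ioc (0 : ℝ) 1)ᵒᵈ ×ₗ ℕ :=
  toLex (OrderDual.toDual s.1, (s.2 : ℕ))

/-- The position of an entry in the list of all entries, sorted by decreasing weight. -/
noncomputable def rank (φ : ElementFreeDist) (s : φ.Entries) : ℕ :=
  {s' | φ.entryKey s' < φ.entryKey s}.ncard

/-- The `n`-th largest weight, counted with multiplicity; zero if there is none. -/
noncomputable def weight (φ : ElementFreeDist) : ℕ → ℝ≥0∞ :=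
  Function.extend φ.rank (fun s => ENNReal.ofReal (s.1 : ℝ)) 0

variable (φ : ElementFreeDist)

lemma entryKey_injective : Function.Injective φ.entryKey := by
  rintro ⟨r, i⟩ ⟨r', i'⟩ h
  simp only [entryKey, EmbeddingLike.apply_eq_iff_eq, Prod.mk.injEq] at h
  obtain ⟨rfl, h⟩ := h
  rw [Fin.ext h]

variable {φ} in
lemma weight_le_of_entryKey_le {s s' : φ.Entries} (h : φ.entryKey s' ≤ φ.entryKey s) :
    s.1 ≤ s'.1 :=
  (Prod.Lex.monotone_fst _ _ h : _)

lemma finite_setOf_le_weight (t : Ioc (0 : ℝ) 1) : {s : φ.Entries | t ≤ s.1}.Finite := by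
  have hsum : ∑' s : φ.Entries, ENNReal.ofReal (s.1 : ℝ) ≠ ∞ := by
    rw [← totalWeight_eq_tsum]
    exact ne_top_of_le_ne_top ENNReal.one_ne_top φ.tsum_le_one
  exact (ENNReal.finite_const_le_of_tsum_ne_top hsum (by simpa using t.2.1)).subset
    fun s hs => ENNReal.ofReal_le_ofReal hs

lemma rank_lt_ncard {s : φ.Entries} {S : Set φ.Entries} (hS : S.Finite) (hs : s ∈ S)
    (hlower : ∀ s', φ.entryKey s' < φ.entryKey s → s' ∈ S) : φ.rank s < S.ncard :=
  ncard_lt_ncard ⟨hlower, not_subset.2 ⟨s, hs, by simp⟩⟩ hS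

lemma rank_injective : Function.Injective φ.rank := by
  have hlt {s s' : φ.Entries} (h : φ.entryKey s < φ.entryKey s') : φ.rank s < φ.rank s' :=
    φ.rank_lt_ncard ((φ.finite_setOf_le_weight s'.1).subset
      fun _ hs => weight_le_of_entryKey_le (le_of_lt hs)) h fun _ hs => hs.trans h
  intro s s' hrank
  rcases lt_trichotomy (φ.entryKey s) (φ.entryKey s') with h | h | h
  · exact absurd hrank (hlt h).ne
  · exact φ.entryKey_injective h
  · exact absurd hrank (hlt h).ne'

lemma image_rank_setOf_le_weight (t : Ioc (0 : ℝ) 1) :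
    φ.rank '' {s | t ≤ s.1} = Iio {s : φ.Entries | t ≤ s.1}.ncard := by
  refine eq_of_subset_of_ncard_le ?_ ?_ (finite_Iio _)
  · rintro _ ⟨s, hs, rfl⟩
    exact φ.rank_lt_ncard (φ.finite_setOf_le_weight t) hs
      fun s' hs' => le_trans hs (weight_le_of_entryKey_le hs'.le)
  · rw [ncard_image_of_injective _ φ.rank_injective, ncard_Iio_nat]

lemma weight_rank (s : φ.Entries) : φ.weight (φ.rank s) = ENNReal.ofReal (s.1 : ℝ) :=
  φ.rank_injective.extend_apply _ _ s

lemma weight_eq_zero {n : ℕ} (hn : n ∉ range φ.rank) : φ.weight n = 0 :=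
  Function.extend_apply' _ _ n hn

lemma tsum_weight_mul (f : ℕ → ℝ≥0∞) :
    ∑' n, φ.weight n * f n = ∑' s : φ.Entries, ENNReal.ofReal (s.1 : ℝ) * f (φ.rank s) := by
  rw [← φ.rank_injective.tsum_eq fun n hn => not_not.1 fun h => hn (by
    simp only [φ.weight_eq_zero h, zero_mul])]
  simp only [weight_rank]

lemma totalWeight_eq_tsum_weight : φ.totalWeight = ∑' n, φ.weight n := by
  simpa [totalWeight_eq_tsum] using (φ.tsum_weight_mul 1).symm

lemma weight_le_one (n : ℕ) : φ.weight n ≤ 1 :=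
  (ENNReal.le_tsum n).trans (φ.totalWeight_eq_tsum_weight.symm.trans_le φ.tsum_le_one)

lemma ofReal_le_weight_iff (t : Ioc (0 : ℝ) 1) (n : ℕ) :
    ENNReal.ofReal (t : ℝ) ≤ φ.weight n ↔ (n : ℕ∞) < φ.count (Ici t) := by
  have hcount : φ.count (Ici t) = ({s : φ.Entries | t ≤ s.1}.ncard : ℕ∞) :=
    (φ.finite_setOf_le_weight t).cast_ncard_eq.symm
  rw [hcount, Nat.cast_lt, ← mem_Iio, ← image_rank_setOf_le_weight]
  by_cases hn : n ∈ range φ.rank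
  · obtain ⟨s, rfl⟩ := hn
    rw [weight_rank, φ.rank_injective.mem_set_image, ENNReal.ofReal_le_ofReal_iff s.1.2.1.le]
    rfl
  · rw [φ.weight_eq_zero hn, nonpos_iff_eq_zero, ENNReal.ofReal_eq_zero]
    exact iff_of_false t.2.1.not_ge fun h => hn (image_subset_range _ _ h)

lemma measurable_weight (n : ℕ) : Measurable fun φ : ElementFreeDist => φ.weight n := by
  refine measurable_of_Ici fun a => ?_
  rcases eq_or_ne a 0 with rfl | h0
  · simp
  rcases lt_or_ge 1 a with h1 | h1
  · convert MeasurableSet.empty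
    ext φ
    simpa using (φ.weight_le_one n).trans_lt h1
  obtain ⟨t, rfl⟩ := exists_ofReal_Ioc_eq h0 h1
  simp only [preimage, mem_Ici, ofReal_le_weight_iff]
  exact measurable_count measurableSet_Ici (.of_discrete (s := Ioi (n : ℕ∞)))

lemma measurable_totalWeight : Measurable totalWeight := by
  simp only [funext totalWeight_eq_tsum_weight]
  exact Measurable.tsum measurable_weight

end ElementFreeDist

section IID

variable {X Y : Type*} [MeasurableSpace X] [MeasurableSpace Y]

lemma measurable_infinitePi_const (ι : Type*) :
    Measurable fun μ : ProbabilityMeasure X => Measure.infinitePi fun _ : ι => (μ : Measure X) := by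
  refine Measurable.measure_of_isPiSystem_of_isProbabilityMeasure
    generateFrom_squareCylinders.symm
    (isPiSystem_squareCylinders (fun _ => MeasurableSpace.isPiSystem_measurableSet) (by simp)) ?_
  rintro _ ⟨s, t, ht, rfl⟩
  have ht' (i : ι) : MeasurableSet (t i) := ht i (mem_univ i)
  simp only [Measure.infinitePi_pi _ fun i _ => ht' i]
  exact Finset.measurable_fun_prod _ fun i _ =>
    (Measure.measurable_coe (ht' i)).comp measurable_subtype_coe

/-- The law of an independent and identically distributed family of points indexed by `ι`, as a
Markov kernel in the law of a single point. -/
noncomputable def iidKernel (ι X : Type*) [MeasurableSpace X] :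
    Kernel (ProbabilityMeasure X) (ι → X) :=
  ⟨fun μ => Measure.infinitePi fun _ => μ, measurable_infinitePi_const ι⟩

instance (ι : Type*) : IsMarkovKernel (iidKernel ι X) := ⟨fun μ =>
  inferInstanceAs (IsProbabilityMeasure (Measure.infinitePi fun _ => (μ : Measure X)))⟩

lemma map_comp_iidKernel {ι κ : Type*} {e : κ → ι} (he : Function.Injective e)
    (μ : ProbabilityMeasure X) :
    (iidKernel ι X μ).map (fun x => x ∘ e) = iidKernel κ X μ :=
  Measure.map_infinitePi_infinitePi_of_inj he

lemma iidKernel_giryMap (ι : Type*) {f : X → Y} (hf : Measurable f) (μ : ProbabilityMeasure X) :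
    iidKernel ι Y (giryMap hf μ) = (iidKernel ι X μ).map fun x => f ∘ x :=
  (Measure.infinitePi_map_pi _ fun _ => hf).symm

lemma iidKernel_comp_map_giryMap (ι : Type*) {f : X → Y} (hf : Measurable f)
    (P : Measure (ProbabilityMeasure X)) :
    iidKernel ι Y ∘ₘ P.map (giryMap hf) = (iidKernel ι X ∘ₘ P).map fun x => f ∘ x := by
  have hm : Measurable fun x : ι → X => f ∘ x := by fun_prop
  rw [Measure.map_comp _ _ hm, ← Measure.deterministic_comp_eq_map (measurable_giryMap hf),
    Measure.comp_assoc]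
  congr 1
  ext1 μ
  rw [Kernel.map_apply _ hm, Kernel.comp_deterministic_eq_comap, Kernel.comap_apply,
    iidKernel_giryMap]

lemma ae_injective_iidKernel {ι : Type*} [Countable ι] [MeasurableEq X]
    (μ : ProbabilityMeasure X) [NullSingletonClass (μ : Measure X)] :
    ∀ᵐ x ∂(iidKernel ι X μ), Function.Injective x := by
  have hprod : ∀ᵐ p ∂((μ : Measure X).prod μ), p.1 ≠ p.2 := by
    rw [Measure.ae_prod_iff_ae_ae
      (p := fun p => p.1 ≠ p.2) (measurableSet_eq_fun measurable_fst measurable_snd).compl]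
    exact .of_forall fun y => (measure_eq_zero_iff_ae_notMem.1 (measure_singleton y)).mono
      fun z hz h => hz h.symm
  have hpair (i j : ι) (hij : i ≠ j) : ∀ᵐ x ∂(iidKernel ι X μ), x i ≠ x j := by
    rw [← Measure.infinitePi_map_eval_prod (P := fun _ : ι => (μ : Measure X)) hij] at hprod
    exact ae_of_ae_map (f := fun x : ι → X => (x i, x j)) (by fun_prop) hprod
  have hall : ∀ᵐ x ∂(iidKernel ι X μ), ∀ i j, i ≠ j → x i ≠ x j := by
    simpa only [ae_all_iff] using hpair
  filter_upwards [hall] with x hx i j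
  exact not_imp_not.1 (hx i j)

end IID

section Base

variable {X Y : Type*} [MeasurableSpace X] [MeasurableSpace Y]

lemma ElementFreeDist.fill_comp_rank_apply (φ : ElementFreeDist) (μ : ProbabilityMeasure X)
    (x : ℕ → X) {A : Set X} (hA : MeasurableSet A) :
    (φ.fill μ (x ∘ φ.rank) : Measure X) A =
      (1 - φ.totalWeight) * (μ : Measure X) A + ∑' n, φ.weight n * A.indicator 1 (x n) := by
  rw [φ.tsum_weight_mul fun n => A.indicator 1 (x n), coe_fill, Measure.add_apply,
    Measure.smul_apply, smul_eq_mul, φ.alloc_apply _ hA]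
  rfl

lemma measurable_fill_comp_rank :
    Measurable fun q : (ProbabilityMeasure X × ElementFreeDist) × (ℕ → X) =>
      q.1.2.fill q.1.1 (q.2 ∘ q.1.2.rank) := by
  refine Measurable.subtype_mk (Measure.measurable_of_measurable_coe _ fun A hA => ?_)
  suffices h : Measurable fun q : (ProbabilityMeasure X × ElementFreeDist) × (ℕ → X) =>
      (1 - q.1.2.totalWeight) * (q.1.1 : Measure X) A +
        ∑' n, q.1.2.weight n * A.indicator 1 (q.2 n) by
    convert h using 2 with q
    exact q.1.2.fill_comp_rank_apply q.1.1 q.2 hA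
  refine Measurable.add (Measurable.mul ?_ ?_) (Measurable.tsum fun n => Measurable.mul ?_ ?_)
  · exact measurable_const.sub (ElementFreeDist.measurable_totalWeight.comp measurable_fst.snd)
  · exact (Measure.measurable_coe hA).comp (measurable_subtype_coe.comp measurable_fst.fst)
  · exact (ElementFreeDist.measurable_weight n).comp measurable_fst.snd
  · exact (measurable_one.indicator hA).comp ((measurable_pi_apply n).comp measurable_snd)

lemma baseKernel_eq_map (μ : ProbabilityMeasure X) (φ : ElementFreeDist) :
    (baseKernel μ φ : Measure (ProbabilityMeasure X)) =
      (iidKernel φ.Entries X μ).map (φ.fill μ) :=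
  rfl

/-- Indexing the points by rank rather than by entry makes the sample space independent of `φ`, so
that the dependence on `φ` becomes one of the integrand. -/
lemma baseKernel_eq_map_rank (μ : ProbabilityMeasure X) (φ : ElementFreeDist) :
    (baseKernel μ φ : Measure (ProbabilityMeasure X)) =
      (iidKernel ℕ X μ).map fun x => φ.fill μ (x ∘ φ.rank) := by
  rw [baseKernel_eq_map, ← map_comp_iidKernel φ.rank_injective,
    Measure.map_map (φ.measurable_fill μ) (by fun_prop)]
  rfl

lemma measurable_baseKernel :
    Measurable fun p : ProbabilityMeasure X × ElementFreeDist => baseKernel p.1 p.2 := by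
  refine Measurable.subtype_mk (Measure.measurable_of_measurable_coe _ fun B hB => ?_)
  have h : Measurable fun p : ProbabilityMeasure X × ElementFreeDist =>
      (iidKernel ℕ X p.1) {x | p.2.fill p.1 (x ∘ p.2.rank) ∈ B} :=
    Kernel.measurable_kernel_prodMk_left (κ := (iidKernel ℕ X).comap
      (Prod.fst : ProbabilityMeasure X × ElementFreeDist → _) measurable_fst)
      (measurable_fill_comp_rank hB)
  convert h using 2 with p
  exact (congrArg (· B) (baseKernel_eq_map_rank p.1 p.2)).trans
    (Measure.map_apply (measurable_fill_comp_rank.comp measurable_prodMk_left) hB)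

/-- The kernel `φ ↦ base(μ, φ)`. -/
noncomputable def baseAt (μ : ProbabilityMeasure X) :
    Kernel ElementFreeDist (ProbabilityMeasure X) :=
  ⟨fun φ => baseKernel μ φ,
    measurable_subtype_coe.comp (measurable_baseKernel.comp measurable_prodMk_left)⟩

instance (μ : ProbabilityMeasure X) : IsMarkovKernel (baseAt μ) := ⟨fun φ => (baseKernel μ φ).2⟩

lemma baseAt_apply (μ : ProbabilityMeasure X) (φ : ElementFreeDist) :
    baseAt μ φ = (iidKernel φ.Entries X μ).map (φ.fill μ) :=
  rfl

lemma map_giryMap_baseAt {f : X → Y} (hf : Measurable f) (μ : ProbabilityMeasure X) :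
    (baseAt μ).map (giryMap hf) = baseAt (giryMap hf μ) := by
  ext1 φ
  rw [Kernel.map_apply _ (measurable_giryMap hf), baseAt_apply, baseAt_apply, iidKernel_giryMap,
    Measure.map_map (measurable_giryMap hf) (φ.measurable_fill μ),
    Measure.map_map (φ.measurable_fill _) (by fun_prop)]
  exact congrArg (Measure.map · _) (funext fun x => φ.fill_map μ hf x)

lemma isAtomEnumeration_fill [MeasurableSingletonClass X] (φ : ElementFreeDist)
    (μ : ProbabilityMeasure X) [NullSingletonClass (μ : Measure X)] {x : φ.Entries → X}
    (hx : Function.Injective x) : IsAtomEnumeration (φ.fill μ x) x := by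
  have hfill (y : X) : (φ.fill μ x : Measure X) {y} =
      ∑' s : φ.Entries, ENNReal.ofReal (s.1 : ℝ) * ({y} : Set X).indicator 1 (x s) := by
    rw [ElementFreeDist.coe_fill, Measure.add_apply, Measure.smul_apply, measure_singleton,
      smul_zero, zero_add, φ.alloc_apply _ (measurableSet_singleton y)]
  refine ⟨hx, fun s => ?_, fun y => not_imp_comm.1 fun hy => ?_⟩
  · rw [hfill, tsum_eq_single s fun s' hs' => by simp [hx.ne hs']]
    simp
  · rw [hfill, ENNReal.tsum_eq_zero]
    intro s
    simp [show x s ≠ y from fun h => hy ⟨s, h⟩]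

lemma map_multCount_baseAt [MeasurableEq X] (μ : ProbabilityMeasure X)
    [NullSingletonClass (μ : Measure X)] : (baseAt μ).map multCount = Kernel.id := by
  ext1 φ
  have hfill : multCount ∘ φ.fill μ =ᵐ[iidKernel φ.Entries X μ] fun _ => φ := by
    filter_upwards [ae_injective_iidKernel μ] with x hx
    exact (isAtomEnumeration_fill φ μ hx).multCount_eq
  rw [Kernel.map_apply _ measurable_multCount, baseAt_apply,
    Measure.map_map measurable_multCount (φ.measurable_fill μ), Measure.map_congr hfill,
    Measure.map_const, measure_univ, one_smul, Kernel.id_apply]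

end Base

section SampleLaws

variable {X : Type*} [MeasurableSpace X]

lemma tendsto_frequency_iidKernel (ν : ProbabilityMeasure X) {A : Set X} (hA : MeasurableSet A) :
    ∀ᵐ x ∂(iidKernel ℕ X ν), Tendsto
      (fun n : ℕ => (∑ i ∈ Finset.range n, A.indicator (1 : X → ℝ) (x i)) / n) atTop
      (𝓝 ((ν : Measure X).real A)) := by
  have hind : Measurable (A.indicator (1 : X → ℝ)) := measurable_one.indicator hA
  have hm (i : ℕ) : Measurable fun x : ℕ → X => A.indicator (1 : X → ℝ) (x i) :=
    hind.comp (measurable_pi_apply i)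
  have heval (i : ℕ) : (iidKernel ℕ X ν).map (fun x => x i) = ν :=
    Measure.infinitePi_map_eval (fun _ : ℕ => (ν : Measure X)) i
  have hlaw (i : ℕ) : (iidKernel ℕ X ν).map (fun x => A.indicator (1 : X → ℝ) (x i)) =
      (ν : Measure X).map (A.indicator 1) := by
    conv_rhs => rw [← heval i, Measure.map_map hind (measurable_pi_apply i)]
    rfl
  have hmean : ∫ x, A.indicator (1 : X → ℝ) (x 0) ∂(iidKernel ℕ X ν) = (ν : Measure X).real A := by
    rw [← integral_indicator_one hA]
    conv_rhs => rw [← heval 0, integral_map (measurable_pi_apply 0).aemeasurable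
      hind.aestronglyMeasurable]
  have hindep : iIndepFun (fun (i : ℕ) (x : ℕ → X) => A.indicator (1 : X → ℝ) (x i))
      (iidKernel ℕ X ν) :=
    iIndepFun_infinitePi fun _ => hind
  have hint : Integrable (fun x : ℕ → X => A.indicator (1 : X → ℝ) (x 0)) (iidKernel ℕ X ν) :=
    Integrable.of_bound (hm 0).aestronglyMeasurable 1 (.of_forall fun x => by
      simpa using norm_indicator_le_norm_self (1 : X → ℝ) (x 0) (s := A))
  have hident (i : ℕ) : IdentDistrib (fun x : ℕ → X => A.indicator (1 : X → ℝ) (x i))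
      (fun x => A.indicator 1 (x 0)) (iidKernel ℕ X ν) (iidKernel ℕ X ν) :=
    ⟨(hm i).aemeasurable, (hm 0).aemeasurable, (hlaw i).trans (hlaw 0).symm⟩
  rw [← hmean]
  exact strong_law_ae_real (fun (i : ℕ) (x : ℕ → X) => A.indicator (1 : X → ℝ) (x i)) hint
    (fun i j hij => hindep.indepFun hij) hident

/-- A set of probability measures that an infinite sample can almost surely recognise. -/
def IsSampleDetermined (S : Set (ProbabilityMeasure X)) : Prop :=
  ∃ T : Set (ℕ → X), MeasurableSet T ∧ ∀ ν, ∀ᵐ x ∂(iidKernel ℕ X ν), x ∈ T ↔ ν ∈ S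

lemma isSampleDetermined_setOf_measure_mem {A : Set X} (hA : MeasurableSet A) {B : Set ℝ≥0∞}
    (hB : MeasurableSet B) :
    IsSampleDetermined {ν : ProbabilityMeasure X | (ν : Measure X) A ∈ B} := by
  have hlimsup : Measurable fun x : ℕ → X => limsup
      (fun n : ℕ => (∑ i ∈ Finset.range n, A.indicator (1 : X → ℝ) (x i)) / n) atTop :=
    Measurable.limsup fun n => (Finset.measurable_fun_sum _ fun i _ =>
      (measurable_one.indicator hA).comp (measurable_pi_apply i)).div_const _
  refine ⟨_, (ENNReal.measurable_ofReal.comp hlimsup) hB, fun ν => ?_⟩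
  filter_upwards [tendsto_frequency_iidKernel ν hA] with x hx
  rw [mem_preimage, Function.comp_apply, hx.limsup_eq, ofReal_measureReal]

/-- The sets recognised by samples form a `σ`-algebra for which all evaluations `ν ↦ ν A` are
measurable. -/
lemma isSampleDetermined_of_measurableSet {S : Set (ProbabilityMeasure X)} (hS : MeasurableSet S) :
    IsSampleDetermined S := by
  let σ : MeasurableSpace (ProbabilityMeasure X) :=
    { MeasurableSet' := IsSampleDetermined
      measurableSet_empty := ⟨∅, .empty, fun ν => .of_forall fun _ => Iff.rfl⟩
      measurableSet_compl := by
        rintro S ⟨T, hT, h⟩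
        exact ⟨Tᶜ, hT.compl, fun ν => (h ν).mono fun x => not_congr⟩
      measurableSet_iUnion := by
        intro S h
        choose T hT h using h
        refine ⟨⋃ i, T i, .iUnion hT, fun ν => ?_⟩
        filter_upwards [ae_all_iff.2 fun i => h i ν] with x hx
        simp only [mem_iUnion, hx] }
  have hid : Measurable[σ, ProbabilityMeasure.instMeasurableSpace] id :=
    @Measurable.subtype_mk _ _ σ _ _ _ (@Measure.measurable_of_measurable_coe _ _ _ σ _
      fun A hA B hB => isSampleDetermined_setOf_measure_mem hA hB) fun ν => ν.2
  exact hid hS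

lemma exists_comp_iidKernel_eq {S : Set (ProbabilityMeasure X)}
    (hS : MeasurableSet S) : ∃ T : Set (ℕ → X), MeasurableSet T ∧
      ∀ P : Measure (ProbabilityMeasure X), (iidKernel ℕ X ∘ₘ P) T = P S := by
  obtain ⟨T, hT, h⟩ := isSampleDetermined_of_measurableSet hS
  refine ⟨T, hT, fun P => ?_⟩
  rw [Measure.bind_apply hT (Kernel.aemeasurable _), ← lintegral_indicator_one hS]
  refine lintegral_congr fun ν => ?_
  by_cases hν : ν ∈ S
  · rw [indicator_of_mem hν]
    exact (mem_ae_iff_prob_eq_one hT).1 ((h ν).mono fun x hx => hx.2 hν)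
  · rw [indicator_of_notMem hν]
    exact measure_eq_zero_iff_ae_notMem.2 ((h ν).mono fun x hx => by simp [hx, hν])

lemma ext_of_comp_iidKernel {P Q : Measure (ProbabilityMeasure X)} [IsFiniteMeasure P]
    (h : ∀ I : Finset ℕ, iidKernel I X ∘ₘ P = iidKernel I X ∘ₘ Q) : P = Q := by
  have hproj (P : Measure (ProbabilityMeasure X)) (I : Finset ℕ) :
      (iidKernel ℕ X ∘ₘ P).map I.restrict = iidKernel I X ∘ₘ P := by
    rw [Measure.map_comp _ _ (Finset.measurable_restrict I)]
    congr 1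
    ext1 ν
    rw [Kernel.map_apply _ (Finset.measurable_restrict I)]
    exact map_comp_iidKernel Subtype.val_injective ν
  have hseq : iidKernel ℕ X ∘ₘ P = iidKernel ℕ X ∘ₘ Q :=
    IsProjectiveLimit.unique (hproj P) fun I => (hproj Q I).trans (h I).symm
  ext S hS
  obtain ⟨T, -, hT⟩ := exists_comp_iidKernel_eq hS
  rw [← hT, ← hT, hseq]

end SampleLaws

section Partitions

variable {ι X : Type*} [MeasurableSpace X]

instance : MeasurableSpace (Setoid ι) := ⊤

lemma finite_setoid [Finite ι] : Finite (Setoid ι) :=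
  Finite.of_injective (fun c : Setoid ι => c.r) fun _ _ h => Setoid.ext fun i j =>
    iff_of_eq (congrFun₂ h i j)

lemma measurable_setoid_ker [MeasurableEq X] [Finite ι] :
    Measurable fun x : ι → X => Setoid.ker x := by
  have := finite_setoid (ι := ι)
  refine measurable_to_countable' fun c => ?_
  have hc : (fun x : ι → X => Setoid.ker x) ⁻¹' {c} = ⋂ (i) (j), {x | x i = x j ↔ c i j} := by
    ext x
    simp [Setoid.ext_iff, Setoid.ker_def]
  rw [hc]
  exact .iInter fun i => .iInter fun j =>
    (measurableSet_eq_fun (measurable_pi_apply i) (measurable_pi_apply j)).iff (.const _)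

/-- The law of the random partition of `ι` into the level sets of an independent and identically
distributed family of points, as a kernel in the law of a single point. -/
noncomputable def partitionKernel (ι X : Type*) [MeasurableSpace X] :
    Kernel (ProbabilityMeasure X) (Setoid ι) :=
  (iidKernel ι X).map Setoid.ker

lemma partitionKernel_apply [MeasurableEq X] [Finite ι] (μ : ProbabilityMeasure X) :
    partitionKernel ι X μ = (iidKernel ι X μ).map Setoid.ker :=
  Kernel.map_apply _ measurable_setoid_ker _

variable {T : Type*} [MeasurableSpace T] (ν : Measure T) [IsProbabilityMeasure ν]

/-- The law of a random labelling of `ι` that is constant on the classes of an equivalence relation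
and gives independent labels with law `ν` to distinct classes, as a kernel in the relation. -/
noncomputable def labelKernel (ι : Type*) : Kernel (Setoid ι) (ι → T) :=
  ⟨fun c => (Measure.infinitePi fun _ : Quotient c => ν).map fun θ i => θ ⟦i⟧, measurable_from_top⟩

lemma labelKernel_ker {α : Type*} (x : ι → α) :
    labelKernel ν ι (Setoid.ker x) = (Measure.infinitePi fun _ : α => ν).map fun θ => θ ∘ x := by
  have hlift : (Measure.infinitePi fun _ : α => ν).map (fun θ c => θ (Setoid.kerLift x c)) =
      Measure.infinitePi fun _ => ν :=
    Measure.map_infinitePi_infinitePi_of_inj (Setoid.kerLift_injective x)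
  change (Measure.infinitePi fun _ => ν).map _ = _
  rw [← hlift, Measure.map_map (by fun_prop) (by fun_prop)]
  rfl

lemma map_add_comp_eq_labelKernel {α : Type*} [AddGroup T] [MeasurableAdd T]
    [ν.IsAddLeftInvariant] {t : ι → T} {x : ι → α} (h : t.FactorsThrough x) :
    (Measure.infinitePi fun _ : α => ν).map (fun θ i => t i + θ (x i)) =
      labelKernel ν ι (Setoid.ker x) := by
  have hinv : (Measure.infinitePi fun _ : α => ν).map
      (fun θ a => Function.extend x t 0 a + θ a) = Measure.infinitePi fun _ => ν := by
    rw [Measure.infinitePi_map_pi (f := fun a u => Function.extend x t 0 a + u) _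
      fun a => measurable_const_add _]
    simp_rw [map_add_left_eq_self]
  conv_rhs => rw [labelKernel_ker, ← hinv]
  rw [Measure.map_map (by fun_prop)
    (measurable_pi_lambda _ fun a => (measurable_pi_apply a).const_add _)]
  simp only [Function.comp_def, h.extend_apply]

end Partitions

section BlockMap

instance : IsProbabilityMeasure (volume : Measure UnitAddCircle) := ⟨UnitAddCircle.measure_univ⟩

/-- Winds the real line around the circle, rotating the lap `(n - 1, n]` by `θ n`. -/
noncomputable def rotatedLap (θ : ℕ → UnitAddCircle) (y : ℝ) : UnitAddCircle := y + θ ⌈y⌉₊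

lemma measurable_uncurry_rotatedLap : Measurable (Function.uncurry rotatedLap) := by
  have heval : Measurable fun p : (ℕ → UnitAddCircle) × ℕ => p.1 p.2 :=
    measurable_from_prod_countable_left measurable_pi_apply
  exact (AddCircle.measurable_mk'.comp measurable_snd).add
    (heval.comp (measurable_fst.prodMk (Nat.measurable_ceil.comp measurable_snd)))

lemma measurable_rotatedLap (θ : ℕ → UnitAddCircle) : Measurable (rotatedLap θ) :=
  measurable_uncurry_rotatedLap.comp measurable_prodMk_left

lemma map_rotatedLap_restrict_Ioc_succ (θ : ℕ → UnitAddCircle) (n : ℕ) :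
    (volume.restrict (Ioc (n : ℝ) (n + 1))).map (rotatedLap θ) = volume := by
  have hlap : rotatedLap θ =ᵐ[volume.restrict (Ioc (n : ℝ) (n + 1))]
      fun y => (y : UnitAddCircle) + θ (n + 1) := by
    filter_upwards [ae_restrict_mem measurableSet_Ioc] with y hy
    rw [rotatedLap, (Nat.ceil_eq_iff n.succ_ne_zero).2 (by simpa using hy)]
  have hrot := (measurePreserving_add_right volume (θ (n + 1))).comp
    (UnitAddCircle.measurePreserving_mk (n : ℝ))
  exact (Measure.map_congr hlap).trans hrot.map_eq

lemma map_rotatedLap_restrict_Ioc (θ : ℕ → UnitAddCircle) (n : ℕ) :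
    (volume.restrict (Ioc (0 : ℝ) n)).map (rotatedLap θ) = n • volume := by
  induction n with
  | zero => simp
  | succ n ih =>
    have hunion : Ioc (0 : ℝ) (n + 1 : ℕ) = Ioc 0 (n : ℝ) ∪ Ioc (n : ℝ) (n + 1) := by
      rw [Nat.cast_succ, Ioc_union_Ioc_eq_Ioc n.cast_nonneg (by linarith)]
    rw [hunion, Measure.restrict_union (Ioc_disjoint_Ioc_of_le le_rfl) measurableSet_Ioc,
      Measure.map_add _ _ (measurable_rotatedLap θ), ih, map_rotatedLap_restrict_Ioc_succ,
      succ_nsmul]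

/-- Stretches the unit interval to `N` laps around the circle and rotates the `j`-th lap by
`θ j`. -/
noncomputable def blockMap (N : ℕ) (θ : ℕ → UnitAddCircle) (x : unitInterval) : UnitAddCircle :=
  rotatedLap θ (N * x)

lemma measurable_uncurry_blockMap (N : ℕ) : Measurable (Function.uncurry (blockMap N)) :=
  measurable_uncurry_rotatedLap.comp
    (measurable_fst.prodMk (measurable_subtype_coe.comp measurable_snd |>.const_mul _))

lemma measurable_blockMap (N : ℕ) (θ : ℕ → UnitAddCircle) : Measurable (blockMap N θ) :=
  (measurable_uncurry_blockMap N).comp measurable_prodMk_left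

lemma map_mul_restrict_Ioc {c : ℝ} (hc : 0 < c) :
    (volume.restrict (Ioc 0 1)).map (fun x => c * x) =
      ENNReal.ofReal c⁻¹ • volume.restrict (Ioc 0 c) := by
  have hpre : Ioc (0 : ℝ) 1 = (fun x => c * x) ⁻¹' Ioc 0 c := by
    rw [preimage_const_mul_Ioc₀ _ _ hc, zero_div, div_self hc.ne']
  rw [hpre, ← Measure.restrict_map (measurable_const_mul c) measurableSet_Ioc,
    Real.map_volume_mul_left hc.ne', abs_of_pos (inv_pos.2 hc), Measure.restrict_smul]

lemma map_blockMap {N : ℕ} (hN : N ≠ 0) (θ : ℕ → UnitAddCircle) :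
    (volume : Measure unitInterval).map (blockMap N θ) = volume := by
  have hN' : (0 : ℝ) < N := by positivity
  have hval : (volume : Measure unitInterval).map Subtype.val = volume.restrict (Ioc 0 1) :=
    (measurePreserving_subtype_coe (μa := volume) measurableSet_Icc).map_eq.trans
      restrict_Ioc_eq_restrict_Icc.symm
  have hcomp : blockMap N θ = rotatedLap θ ∘ (fun x : ℝ => N * x) ∘ Subtype.val := rfl
  rw [hcomp, ← Measure.map_map (measurable_rotatedLap θ)
      ((measurable_const_mul _).comp measurable_subtype_coe),
    ← Measure.map_map (measurable_const_mul _) measurable_subtype_coe, hval,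
    map_mul_restrict_Ioc hN', Measure.map_smul, map_rotatedLap_restrict_Ioc,
    ← Nat.cast_smul_eq_nsmul ℝ≥0∞, smul_smul, ENNReal.ofReal_inv_of_pos hN',
    ENNReal.ofReal_natCast, ENNReal.inv_mul_cancel (by simpa using hN) (by simp), one_smul]

lemma eventually_ceil_mul_ne {x y : ℝ} (hx : 0 ≤ x) (hy : 0 ≤ y) (h : x ≠ y) :
    ∀ᶠ N : ℕ in atTop, ⌈N * x⌉₊ ≠ ⌈N * y⌉₊ := by
  wlog hxy : x < y generalizing x y
  · exact (this hy hx h.symm (lt_of_le_of_ne (not_lt.1 hxy) h.symm)).mono fun _ => Ne.symm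
  have hgap : ∀ᶠ N : ℕ in atTop, 1 ≤ N * (y - x) :=
    (tendsto_natCast_atTop_atTop.atTop_mul_const (sub_pos.2 hxy)).eventually_ge_atTop 1
  filter_upwards [hgap] with N hN heq
  have hlt : (⌈N * x⌉₊ : ℝ) < N * x + 1 := Nat.ceil_lt_add_one (by positivity)
  have hle : N * y ≤ ⌈N * y⌉₊ := Nat.le_ceil _
  rw [heq] at hlt
  linarith

lemma eventually_ker_ceil_mul_eq {ι : Type*} [Finite ι] (x : ι → unitInterval) :
    ∀ᶠ N : ℕ in atTop, Setoid.ker (fun i => ⌈(N * x i : ℝ)⌉₊) = Setoid.ker x := by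
  have hsep (i j : ι) : ∀ᶠ N : ℕ in atTop, x i ≠ x j → ⌈(N * x i : ℝ)⌉₊ ≠ ⌈(N * x j : ℝ)⌉₊ := by
    by_cases hij : x i = x j
    · exact .of_forall fun N h => absurd hij h
    · exact (eventually_ceil_mul_ne (x i).2.1 (x j).2.1 (Subtype.coe_injective.ne hij)).mono
        fun N hN _ => hN
  filter_upwards [eventually_all.2 fun i => eventually_all.2 (hsep i)] with N hN
  ext i j
  exact ⟨not_imp_not.1 (hN i j), fun h => by rw [Setoid.ker_def] at h ⊢; rw [h]⟩

end BlockMap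

section Averaging

section RandomMap

variable {Ω Θ E : Type*} [MeasurableSpace Ω] [MeasurableSpace Θ] [MeasurableSpace E]
  (κ : Measure Θ) {F : Θ → Ω → E} {S : Set E}

lemma map_apply_eq_measure_preimage_uncurry (hF : Measurable (Function.uncurry F))
    (hS : MeasurableSet S) (x : Ω) :
    κ.map (fun θ => F θ x) S = κ ((fun θ => (θ, x)) ⁻¹' (Function.uncurry F ⁻¹' S)) :=
  Measure.map_apply (hF.comp measurable_prodMk_right) hS

lemma measurable_map_apply [SFinite κ] (hF : Measurable (Function.uncurry F))
    (hS : MeasurableSet S) : Measurable fun x => κ.map (fun θ => F θ x) S := by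
  simp_rw [map_apply_eq_measure_preimage_uncurry κ hF hS]
  exact measurable_measure_prodMk_right (hF hS)

lemma apply_eq_lintegral_of_forall_map_eq [IsProbabilityMeasure κ] {M : Measure Ω} [SFinite M]
    {M' : Measure E} (hF : Measurable (Function.uncurry F)) (hS : MeasurableSet S)
    (h : ∀ θ, M.map (F θ) = M') : M' S = ∫⁻ x, κ.map (fun θ => F θ x) S ∂M :=
  calc M' S = ∫⁻ θ, M.map (F θ) S ∂κ := by simp [h]
    _ = ∫⁻ θ, M (Prod.mk θ ⁻¹' (Function.uncurry F ⁻¹' S)) ∂κ :=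
      lintegral_congr fun θ => Measure.map_apply (hF.comp measurable_prodMk_left) hS
    _ = ∫⁻ x, κ ((fun θ => (θ, x)) ⁻¹' (Function.uncurry F ⁻¹' S)) ∂M := by
      rw [← Measure.prod_apply (hF hS), Measure.prod_apply_symm (hF hS)]
    _ = ∫⁻ x, κ.map (fun θ => F θ x) S ∂M := by
      simp_rw [map_apply_eq_measure_preimage_uncurry κ hF hS]

end RandomMap

variable {ι : Type*}

lemma measurable_uncurry_blockMap_comp (N : ℕ) :
    Measurable (Function.uncurry fun θ (x : ι → unitInterval) => blockMap N θ ∘ x) :=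
  measurable_pi_lambda _ fun i => (measurable_uncurry_blockMap N).comp
    (measurable_fst.prodMk ((measurable_pi_apply i).comp measurable_snd))

variable [Finite ι]

lemma eventually_map_blockMap_comp_eq_labelKernel (x : ι → unitInterval) :
    ∀ᶠ N : ℕ in atTop, (Measure.infinitePi fun _ : ℕ => (volume : Measure UnitAddCircle)).map
      (fun θ => blockMap N θ ∘ x) = labelKernel volume ι (Setoid.ker x) := by
  filter_upwards [eventually_ker_ceil_mul_eq x] with N hN
  have ht : Function.FactorsThrough (fun i => ((N * x i : ℝ) : UnitAddCircle))
      fun i => ⌈(N * x i : ℝ)⌉₊ := by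
    intro i j hij
    have hx : x i = x j := (Setoid.ext_iff.1 hN i j).1 hij
    simp only [hx]
  rw [← hN]
  exact map_add_comp_eq_labelKernel volume ht

/-- As `N → ∞`, a random `blockMap N` attaches independent uniform labels to distinct points. -/
lemma iidKernel_comp_eq_labelKernel_comp {P : Measure (ProbabilityMeasure unitInterval)}
    [IsFiniteMeasure P] {Q : Measure (ProbabilityMeasure UnitAddCircle)}
    (h : ∀ N ≠ 0, ∀ θ, P.map (giryMap (measurable_blockMap N θ)) = Q) :
    iidKernel ι UnitAddCircle ∘ₘ Q =
      labelKernel volume ι ∘ₘ (partitionKernel ι unitInterval ∘ₘ P) := by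
  set M := iidKernel ι unitInterval ∘ₘ P
  set κ := Measure.infinitePi fun _ : ℕ => (volume : Measure UnitAddCircle)
  have hM : partitionKernel ι unitInterval ∘ₘ P = M.map Setoid.ker :=
    (Measure.map_comp P _ measurable_setoid_ker).symm
  ext S hS
  have hN : ∀ᶠ N : ℕ in atTop, ∫⁻ x, κ.map (fun θ => blockMap N θ ∘ x) S ∂M =
      (iidKernel ι UnitAddCircle ∘ₘ Q) S := by
    filter_upwards [eventually_ne_atTop 0] with N hN
    refine (apply_eq_lintegral_of_forall_map_eq κ (measurable_uncurry_blockMap_comp N) hS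
      fun θ => ?_).symm
    rw [← h N hN θ, iidKernel_comp_map_giryMap]
  have hlim : Tendsto (fun N : ℕ => ∫⁻ x, κ.map (fun θ => blockMap N θ ∘ x) S ∂M) atTop
      (𝓝 (∫⁻ x, labelKernel volume ι (Setoid.ker x) S ∂M)) := by
    refine tendsto_lintegral_of_dominated_convergence (fun _ => 1) (fun N => ?_)
      (fun N => .of_forall fun x => ?_) (by simp) (.of_forall fun x => ?_)
    · exact measurable_map_apply κ (measurable_uncurry_blockMap_comp N) hS
    · exact prob_le_one
    · exact tendsto_const_nhds.congr' <|
        (eventually_map_blockMap_comp_eq_labelKernel x).mono fun N hN =>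
          congrArg (· S) hN.symm
  rw [tendsto_nhds_unique (tendsto_const_nhds.congr' <| hN.mono fun _ => Eq.symm) hlim, hM,
    Measure.bind_apply hS (Kernel.aemeasurable _),
    lintegral_map (Kernel.measurable_coe _ hS) measurable_setoid_ker]

end Averaging

section Coupling

variable {X Y ι : Type*} [MeasurableSpace X] [MeasurableSpace Y] {ν : ProbabilityMeasure X}
  {ν' : ProbabilityMeasure Y}

lemma partitionKernel_eq_of_coupling [MeasurableEq X] [MeasurableEq Y] [Finite ι]
    {ρ : Measure (X × Y)} (hfst : ρ.map Prod.fst = ν) (hsnd : ρ.map Prod.snd = ν')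
    (hρ : ∀ᵐ z ∂(ρ.prod ρ), z.1.1 = z.2.1 ↔ z.1.2 = z.2.2) :
    partitionKernel ι X ν = partitionKernel ι Y ν' := by
  have : IsProbabilityMeasure ρ := by
    have : IsProbabilityMeasure (ρ.map Prod.fst) := hfst ▸ ν.2
    exact Measure.isProbabilityMeasure_of_map Prod.fst
  set M := Measure.infinitePi fun _ : ι => ρ
  have hX : M.map (fun z i => (z i).1) = iidKernel ι X ν := by
    rw [Measure.infinitePi_map_pi (f := fun _ => Prod.fst) _ fun _ => measurable_fst]
    simp only [hfst]
    rfl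
  have hY : M.map (fun z i => (z i).2) = iidKernel ι Y ν' := by
    rw [Measure.infinitePi_map_pi (f := fun _ => Prod.snd) _ fun _ => measurable_snd]
    simp only [hsnd]
    rfl
  have hpair (i j : ι) : ∀ᵐ z ∂M, (z i).1 = (z j).1 ↔ (z i).2 = (z j).2 := by
    by_cases hij : i = j
    · simp [hij]
    · rw [← Measure.infinitePi_map_eval_prod (P := fun _ : ι => ρ) hij] at hρ
      exact ae_of_ae_map (f := fun z : ι → X × Y => (z i, z j)) (by fun_prop) hρ
  rw [partitionKernel_apply, partitionKernel_apply, ← hX, ← hY,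
    Measure.map_map measurable_setoid_ker (by fun_prop),
    Measure.map_map measurable_setoid_ker (by fun_prop)]
  refine Measure.map_congr ?_
  filter_upwards [ae_all_iff.2 fun i => ae_all_iff.2 (hpair i)] with z hz
  exact Setoid.ext hz

variable {φ : ElementFreeDist} {a : φ.Entries → X} {a' : φ.Entries → Y}

lemma IsAtomEnumeration.measure_compl_range [MeasurableSingletonClass X]
    (ha : IsAtomEnumeration ν a) : (ν : Measure X) (range a)ᶜ = 1 - φ.totalWeight := by
  have hsum := congrArg (fun m : Measure X => m univ) ha.restrict_compl_add_alloc
  simp only [Measure.add_apply, Measure.restrict_apply_univ, φ.alloc_univ, measure_univ] at hsum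
  exact ENNReal.eq_sub_of_add_eq (ne_top_of_le_ne_top ENNReal.one_ne_top φ.tsum_le_one) hsum

/-- The coupling of two measures, whose atoms are enumerated by `a` and `a'`, that pairs
corresponding atoms and makes the two points independent outside of the atoms. -/
noncomputable def atomCoupling (ν : ProbabilityMeasure X) (ν' : ProbabilityMeasure Y)
    (a : φ.Entries → X) (a' : φ.Entries → Y) : Measure (X × Y) :=
  (1 - φ.totalWeight)⁻¹ •
    ((ν : Measure X).restrict (range a)ᶜ).prod ((ν' : Measure Y).restrict (range a')ᶜ) +
  φ.alloc fun s => (a s, a' s)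

lemma inv_smul_measure_univ_smul (μ : Measure X) [IsFiniteMeasure μ] :
    (μ univ)⁻¹ • μ univ • μ = μ := by
  rcases eq_or_ne μ 0 with rfl | hμ
  · simp
  · rw [smul_smul, ENNReal.inv_mul_cancel (by simpa using hμ) (measure_ne_top _ _), one_smul]

variable [MeasurableSingletonClass X] [MeasurableSingletonClass Y]

lemma map_fst_atomCoupling (ha : IsAtomEnumeration ν a) (ha' : IsAtomEnumeration ν' a') :
    (atomCoupling ν ν' a a').map Prod.fst = ν := by
  have hdiffuse := inv_smul_measure_univ_smul ((ν : Measure X).restrict (range a)ᶜ)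
  rw [Measure.restrict_apply_univ, ha.measure_compl_range] at hdiffuse
  rw [atomCoupling, Measure.map_add _ _ measurable_fst, Measure.map_smul, Measure.map_fst_prod,
    Measure.restrict_apply_univ, ha'.measure_compl_range, hdiffuse, φ.alloc_map _ measurable_fst]
  exact ha.restrict_compl_add_alloc

lemma map_snd_atomCoupling (ha : IsAtomEnumeration ν a) (ha' : IsAtomEnumeration ν' a') :
    (atomCoupling ν ν' a a').map Prod.snd = ν' := by
  have hdiffuse := inv_smul_measure_univ_smul ((ν' : Measure Y).restrict (range a')ᶜ)
  rw [Measure.restrict_apply_univ, ha'.measure_compl_range] at hdiffuse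
  rw [atomCoupling, Measure.map_add _ _ measurable_snd, Measure.map_smul, Measure.map_snd_prod,
    Measure.restrict_apply_univ, ha.measure_compl_range, hdiffuse, φ.alloc_map _ measurable_snd]
  exact ha'.restrict_compl_add_alloc

lemma ae_atomCoupling :
    ∀ᵐ z ∂(atomCoupling ν ν' a a'), (∃ s, z = (a s, a' s)) ∨ z.1 ∉ range a ∧ z.2 ∉ range a' := by
  rw [atomCoupling, ae_add_measure_iff]
  constructor
  · refine Measure.ae_smul_measure ?_ _
    filter_upwards [Measure.quasiMeasurePreserving_fst.ae
        (ae_restrict_mem (countable_range a).measurableSet.compl),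
      Measure.quasiMeasurePreserving_snd.ae
        (ae_restrict_mem (countable_range a').measurableSet.compl)] with z hz hz'
    exact .inr ⟨hz, hz'⟩
  · rw [ElementFreeDist.alloc, Measure.ae_sum_iff]
    refine fun s => Measure.ae_smul_measure ?_ _
    rw [ae_dirac_eq]
    exact .inl ⟨s, rfl⟩

end Coupling

section PartitionLaw

variable {X Y ι : Type*} [MeasurableSpace X] [MeasurableEq X] [MeasurableSpace Y] [MeasurableEq Y]
  {ν : ProbabilityMeasure X} {ν' : ProbabilityMeasure Y}
  {φ : ElementFreeDist} {a : φ.Entries → X} {a' : φ.Entries → Y}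

lemma ae_prod_atomCoupling (ha : IsAtomEnumeration ν a) (ha' : IsAtomEnumeration ν' a') :
    ∀ᵐ z ∂((atomCoupling ν ν' a a').prod (atomCoupling ν ν' a a')),
      z.1.1 = z.2.1 ↔ z.1.2 = z.2.2 := by
  have hfst := map_fst_atomCoupling ha ha'
  have hsnd := map_snd_atomCoupling ha ha'
  have : IsProbabilityMeasure (atomCoupling ν ν' a a') := by
    have : IsProbabilityMeasure ((atomCoupling ν ν' a a').map Prod.fst) := hfst ▸ ν.2
    exact Measure.isProbabilityMeasure_of_map Prod.fst
  have hmeas : MeasurableSet {z : (X × Y) × (X × Y) | z.1.1 = z.2.1 ↔ z.1.2 = z.2.2} :=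
    (measurableSet_eq_fun measurable_fst.fst measurable_snd.fst).iff
      (measurableSet_eq_fun measurable_fst.snd measurable_snd.snd)
  rw [Measure.ae_prod_iff_ae_ae hmeas]
  filter_upwards [ae_atomCoupling] with z hz
  rcases hz with ⟨s, rfl⟩ | ⟨hz, hz'⟩
  · filter_upwards [ae_atomCoupling] with w hw
    rcases hw with ⟨t, rfl⟩ | ⟨hw, hw'⟩
    · exact ha.injective.eq_iff.trans ha'.injective.eq_iff.symm
    · exact iff_of_false (fun h => hw ⟨s, h⟩) fun h => hw' ⟨s, h⟩
  · have hne : ∀ᵐ x ∂((atomCoupling ν ν' a a').map Prod.fst), x ≠ z.1 := by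
      rw [hfst]
      exact measure_eq_zero_iff_ae_notMem.1 (ha.measure_singleton_eq_zero hz)
    have hne' : ∀ᵐ y ∂((atomCoupling ν ν' a a').map Prod.snd), y ≠ z.2 := by
      rw [hsnd]
      exact measure_eq_zero_iff_ae_notMem.1 (ha'.measure_singleton_eq_zero hz')
    filter_upwards [ae_of_ae_map measurable_fst.aemeasurable hne,
      ae_of_ae_map measurable_snd.aemeasurable hne'] with w hw hw'
    exact iff_of_false hw.symm hw'.symm

variable [Finite ι]

lemma IsAtomEnumeration.partitionKernel_eq (ha : IsAtomEnumeration ν a)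
    (ha' : IsAtomEnumeration ν' a') : partitionKernel ι X ν = partitionKernel ι Y ν' :=
  partitionKernel_eq_of_coupling (map_fst_atomCoupling ha ha') (map_snd_atomCoupling ha ha')
    (ae_prod_atomCoupling ha ha')

lemma partitionKernel_comp_baseAt_multCount (μ : ProbabilityMeasure Y)
    [NullSingletonClass (μ : Measure Y)] (ν : ProbabilityMeasure X) :
    partitionKernel ι Y ∘ₘ baseAt μ (multCount ν) = partitionKernel ι X ν := by
  obtain ⟨a, ha⟩ := exists_isAtomEnumeration ν
  have hfill : ∀ᵐ y ∂(iidKernel (multCount ν).Entries Y μ),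
      partitionKernel ι Y ((multCount ν).fill μ y) = partitionKernel ι X ν := by
    filter_upwards [ae_injective_iidKernel μ] with y hy
    exact (isAtomEnumeration_fill _ μ hy).partitionKernel_eq ha
  ext S hS
  rw [Measure.bind_apply hS (Kernel.aemeasurable _), baseAt_apply,
    lintegral_map (Kernel.measurable_coe _ hS) (ElementFreeDist.measurable_fill _ μ),
    lintegral_congr_ae (hfill.mono fun y h => congrArg (· S) h), lintegral_const, measure_univ,
    mul_one]

lemma partitionKernel_comp_eq_comp_map_multCount (μ : ProbabilityMeasure Y)
    [NullSingletonClass (μ : Measure Y)] (P : Measure (ProbabilityMeasure X)) :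
    partitionKernel ι X ∘ₘ P =
      (partitionKernel ι Y ∘ₖ baseAt μ) ∘ₘ P.map multCount := by
  rw [← Measure.deterministic_comp_eq_map measurable_multCount, Measure.comp_assoc]
  congr 1
  ext1 ν
  rw [Kernel.comp_deterministic_eq_comap, Kernel.comap_apply, Kernel.comp_apply,
    partitionKernel_comp_baseAt_multCount]

end PartitionLaw

section UniformCircle

/-- The uniform distribution on the circle. -/
noncomputable def uniformCircle : ProbabilityMeasure UnitAddCircle := ⟨volume, inferInstance⟩

instance : NullSingletonClass (uniformUnit : Measure unitInterval) :=
  inferInstanceAs (NullSingletonClass (volume : Measure unitInterval))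

lemma giryMap_blockMap_uniformUnit {N : ℕ} (hN : N ≠ 0) (θ : ℕ → UnitAddCircle) :
    giryMap (measurable_blockMap N θ) uniformUnit = uniformCircle :=
  Subtype.ext (map_blockMap hN θ)

lemma exists_giryMap_uniformCircle_eq_uniformUnit :
    ∃ (g : UnitAddCircle → unitInterval) (hg : Measurable g),
      giryMap hg uniformCircle = uniformUnit := by
  let e := AddCircle.measurableEquivIoc (1 : ℝ) 0
  have he (u : UnitAddCircle) : (e u : ℝ) ∈ unitInterval :=
    Ioc_subset_Icc_self (by simpa using (e u).2)
  let g (u : UnitAddCircle) : unitInterval := ⟨e u, he u⟩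
  have hg : Measurable g := (measurable_subtype_coe.comp e.measurable).subtype_mk
  have hval : MeasurableEmbedding (Subtype.val : unitInterval → ℝ) :=
    .subtype_coe measurableSet_Icc
  have hunit : (volume : Measure unitInterval).map Subtype.val = volume.restrict (Icc 0 1) :=
    (measurePreserving_subtype_coe (μa := volume) measurableSet_Icc).map_eq
  have hcircle : ((volume : Measure UnitAddCircle).map g).map Subtype.val =
      volume.restrict (Icc 0 1) := by
    have hIoc : volume.restrict (Icc (0 : ℝ) 1) = volume.restrict (Ioc 0 (0 + 1)) := by
      rw [zero_add, restrict_Ioc_eq_restrict_Icc]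
    rw [Measure.map_map measurable_subtype_coe hg, hIoc]
    exact ((measurePreserving_subtype_coe measurableSet_Ioc).comp
      (AddCircle.measurePreserving_equivIoc 1)).map_eq
  refine ⟨g, hg, Subtype.ext ?_⟩
  change (volume : Measure UnitAddCircle).map g = volume
  rw [← hval.comap_map (Measure.map g _), hcircle, ← hunit, hval.comap_map]

lemma exists_giryMap_uniformCircle_eq {X : Type*} [MeasurableSpace X] [StandardBorelSpace X]
    (μ : ProbabilityMeasure X) :
    ∃ (f : UnitAddCircle → X) (hf : Measurable f), giryMap hf uniformCircle = μ := by
  have := nonempty_of_isProbabilityMeasure (μ : Measure X)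
  obtain ⟨f, hf, hfμ⟩ := Measure.exists_measurable_map_eq (μ : Measure X)
  obtain ⟨g, hg, hgU⟩ := exists_giryMap_uniformCircle_eq_uniformUnit
  refine ⟨f ∘ g, hf.comp hg, ProbabilityMeasure.toMeasure_injective ?_⟩
  rw [coe_giryMap, ← Measure.map_map hf hg, ← coe_giryMap hg, hgU]
  exact hfμ

end UniformCircle

namespace GiryNat

variable {X Y : Type} [MeasurableSpace X] [StandardBorelSpace X] [MeasurableSpace Y]
  [StandardBorelSpace Y]

lemma component_giryMap (H : GiryNat) {f : X → Y} (hf : Measurable f) (μ : ProbabilityMeasure X) :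
    H.component Y (giryMap hf μ) = giryMap (measurable_giryMap hf) (H.component X μ) := by
  let X' : Sbs := ⟨MeasCat.of X, inferInstanceAs (StandardBorelSpace X)⟩
  let Y' : Sbs := ⟨MeasCat.of Y, inferInstanceAs (StandardBorelSpace Y)⟩
  let g : X' ⟶ Y' := ⟨⟨f, hf⟩⟩
  exact congrArg (fun k => (k.1 μ : ProbabilityMeasure (ProbabilityMeasure Y))) (H.naturality g)

lemma ext_component {H H' : GiryNat}
    (h : ∀ (X : Type) [MeasurableSpace X] [StandardBorelSpace X] (μ : ProbabilityMeasure X),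
      H.component X μ = H'.component X μ) : H = H' := by
  refine NatTrans.ext (funext fun X => Subtype.ext (funext fun μ => ?_))
  obtain ⟨X, hX⟩ := X
  exact @h X _ hX μ

lemma ext_uniformCircle {H H' : GiryNat}
    (h : H.component UnitAddCircle uniformCircle = H'.component UnitAddCircle uniformCircle) :
    H = H' := by
  refine ext_component fun X _ _ μ => ?_
  obtain ⟨f, hf, rfl⟩ := exists_giryMap_uniformCircle_eq μ
  rw [component_giryMap, component_giryMap, h]

/-- The law of the multiplicity count of the random measure with law `H [0, 1] 𝒰`: the map `β`. -/
noncomputable def multLaw (H : GiryNat) : ProbabilityMeasure ElementFreeDist :=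
  giryMap measurable_multCount (H.component unitInterval uniformUnit)

lemma iidKernel_comp_component_uniformCircle (H : GiryNat) (ι : Type*) [Finite ι] :
    iidKernel ι UnitAddCircle ∘ₘ (H.component UnitAddCircle uniformCircle : Measure _) =
      labelKernel volume ι ∘ₘ ((partitionKernel ι unitInterval ∘ₖ baseAt uniformUnit) ∘ₘ
        (H.multLaw : Measure ElementFreeDist)) := by
  have hblock (N : ℕ) (hN : N ≠ 0) (θ : ℕ → UnitAddCircle) :
      (H.component unitInterval uniformUnit : Measure _).map
        (giryMap (measurable_blockMap N θ)) = H.component UnitAddCircle uniformCircle := by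
    rw [← giryMap_blockMap_uniformUnit hN θ, component_giryMap, coe_giryMap]
  rw [iidKernel_comp_eq_labelKernel_comp hblock,
    partitionKernel_comp_eq_comp_map_multCount uniformUnit]
  rfl

lemma multLaw_injective : Function.Injective multLaw := fun H H' h =>
  ext_uniformCircle <| ProbabilityMeasure.toMeasure_injective <| ext_of_comp_iidKernel fun I => by
    rw [iidKernel_comp_component_uniformCircle, iidKernel_comp_component_uniformCircle, h]

end GiryNat

section BindBase

variable {X Y : Type*} [MeasurableSpace X] [MeasurableSpace Y]

/-- The mixture `(ω >>= base_X)(μ)`. -/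
noncomputable def bindBase (ω : ProbabilityMeasure ElementFreeDist) (μ : ProbabilityMeasure X) :
    ProbabilityMeasure (ProbabilityMeasure X) :=
  ⟨baseAt μ ∘ₘ (ω : Measure ElementFreeDist), inferInstance⟩

lemma measurable_bindBase (ω : ProbabilityMeasure ElementFreeDist) :
    Measurable (bindBase (X := X) ω) := by
  refine Measurable.subtype_mk (Measure.measurable_of_measurable_coe _ fun B hB => ?_)
  simp_rw [Measure.bind_apply hB (Kernel.aemeasurable _)]
  exact Measurable.lintegral_prod_right'
    ((Measure.measurable_coe hB).comp (measurable_subtype_coe.comp measurable_baseKernel))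

lemma bindBase_giryMap (ω : ProbabilityMeasure ElementFreeDist) {f : X → Y} (hf : Measurable f)
    (μ : ProbabilityMeasure X) :
    bindBase ω (giryMap hf μ) = giryMap (measurable_giryMap hf) (bindBase ω μ) := by
  refine Subtype.ext ?_
  change baseAt (giryMap hf μ) ∘ₘ _ = (baseAt μ ∘ₘ _).map (giryMap hf)
  rw [Measure.map_comp _ _ (measurable_giryMap hf), map_giryMap_baseAt]

lemma giryMap_multCount_bindBase [MeasurableEq X] (ω : ProbabilityMeasure ElementFreeDist)
    (μ : ProbabilityMeasure X) [NullSingletonClass (μ : Measure X)] :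
    giryMap measurable_multCount (bindBase ω μ) = ω := by
  refine Subtype.ext ?_
  change (baseAt μ ∘ₘ (ω : Measure ElementFreeDist)).map multCount = ω
  rw [Measure.map_comp _ _ measurable_multCount, map_multCount_baseAt, Measure.id_comp]

/-- The natural transformation with components `ω >>= base_X`: the map `α`. -/
noncomputable def bindBaseNat (ω : ProbabilityMeasure ElementFreeDist) : GiryNat where
  app X := ⟨fun μ : ProbabilityMeasure X.1 => bindBase ω μ, measurable_bindBase ω⟩
  naturality X _ f := Subtype.ext <| funext fun μ : ProbabilityMeasure X.1 =>
    bindBase_giryMap ω f.1.2 μ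

lemma multLaw_bindBaseNat (ω : ProbabilityMeasure ElementFreeDist) :
    (bindBaseNat ω).multLaw = ω :=
  giryMap_multCount_bindBase ω uniformUnit

end BindBase

theorem mainTheorem2 :
    (∀ (X : Type) [MeasurableSpace X] [StandardBorelSpace X],
      Measurable fun p : ProbabilityMeasure X × ElementFreeDist => baseKernel p.1 p.2) ∧
    (∀ (X : Type) [MeasurableSpace X] [StandardBorelSpace X],
      Measurable fun μ : ProbabilityMeasure X => multCount μ) ∧
    ∃ e : ProbabilityMeasure ElementFreeDist ≃ GiryNat,
      (∀ (ω : ProbabilityMeasure ElementFreeDist)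
        (X : Type) [MeasurableSpace X] [StandardBorelSpace X] (μ : ProbabilityMeasure X),
        ((e ω).component X μ : Measure (ProbabilityMeasure X)) =
          (ω : Measure ElementFreeDist).bind
            fun φ => (baseKernel μ φ : Measure (ProbabilityMeasure X))) ∧
      ∀ H : GiryNat,
        (e.symm H : Measure ElementFreeDist) =
          (H.component unitInterval uniformUnit :
            Measure (ProbabilityMeasure unitInterval)).map multCount := by
  refine ⟨fun X _ _ => measurable_baseKernel, fun X _ _ => measurable_multCount,
    ⟨bindBaseNat, GiryNat.multLaw, multLaw_bindBaseNat, fun H => ?_⟩,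
    fun ω X _ _ μ => rfl, fun H => rfl⟩
  exact GiryNat.multLaw_injective (multLaw_bindBaseNat H.multLaw)
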